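/- There exists a finitely generated residually nilpotent group $H$ with solvable word problem that is not effectively residually nilpotent: for no finite generating tuple $S$ of $H$ is there an algorithm that, on input any word $w$ over $S\cup S^{-1}$ representing a non-identity element of $H$, produces a finite presentation of a nilpotent quotient of $H$ in which $w$ has a non-trivial image. (The presentation may use any finite set of generators, and the algorithm is not required to output the quotient map.) Moreover, for no finite generating tuple $S$ of $H$ is there an algorithm that, on input any word $w$ over $S\cup S^{-1}$ representing a non-identity element of $H$, determines an $n$ such that $w$ has a non-trivial image in $H/\gamma_n(H)$, where $\gamma_1(H)=H$ and $\gamma_{n+1}(H)=[\gamma_n(H),H]$. In both cases nothing is required of the algorithm on words that represent the identity. -/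

import Mathlib

/-- A finite generating tuple (a marking) of a group. -/
def IsMarking {G : Type*} [Group G] {k : ℕ} (s : Fin k → G) : Prop :=
  Subgroup.closure (Set.range s) = ⊤

/-- Words over the alphabet `S ∪ S⁻¹` with `S` of size `k`; the letter `(i, true)` stands for the
`i`-th generator and `(i, false)` for its inverse. -/
abbrev GroupWord (k : ℕ) : Type := List (Fin k × Bool)

/-- The element of `G` that a word in the tuple `s` represents. -/
def wordEval {G : Type*} [Group G] {k : ℕ} (s : Fin k → G) (w : GroupWord k) : G :=
  FreeGroup.lift s (FreeGroup.mk w)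

/-- Every non-identity element survives in some nilpotent quotient. -/
def IsResiduallyNilpotent (G : Type*) [Group G] : Prop :=
  ∀ g : G, g ≠ 1 → ∃ (N : Subgroup G) (_ : N.Normal), Group.IsNilpotent (G ⧸ N) ∧ g ∉ N

/-- The word problem of a finitely generated group (it does not depend on the marking). -/
def HasSolvableWordProblem (G : Type*) [Group G] : Prop :=
  ∃ (k : ℕ) (s : Fin k → G), IsMarking s ∧
    ComputablePred fun w : GroupWord k => wordEval s w = 1

/-- A finite presentation as a finite object: a number `m` of generators `x₀, …, xₘ₋₁`, and a list
of relators, each a word in the letters `(i, true) = xᵢ` and `(i, false) = xᵢ⁻¹`. -/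
abbrev FinPresentation : Type := ℕ × List (List (ℕ × Bool))

/-- A relator as an element of the free group on `m` generators; letters whose index is
not below `m` denote no generator and are ignored. -/
def relatorElem (m : ℕ) (r : List (ℕ × Bool)) : FreeGroup (Fin m) :=
  FreeGroup.lift (fun i : ℕ => if h : i < m then FreeGroup.of (⟨i, h⟩ : Fin m) else 1)
    (FreeGroup.mk r)

/-- The group `⟨x₀, …, xₘ₋₁ | R⟩` defined by a finite presentation `(m, R)`. -/
abbrev FinPresentation.Carrier (P : FinPresentation) : Type :=
  PresentedGroup {x : FreeGroup (Fin P.1) | ∃ r ∈ P.2, relatorElem P.1 r = x}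

/-- A finitely generated group is effectively residually nilpotent if some algorithm, on input a
word for a non-identity element `w`, halts and outputs a finite presentation of a nilpotent
quotient of `G` in which `w` has a non-trivial image. Nothing is asked of the algorithm on words
for the identity, and it need not output the quotient map. -/
def IsEffectivelyResiduallyNilpotent (G : Type*) [Group G] : Prop :=
  ∃ (k : ℕ) (s : Fin k → G), IsMarking s ∧
    ∃ f : GroupWord k →. FinPresentation, Partrec f ∧
      ∀ w : GroupWord k, wordEval s w ≠ 1 →
        ∃ P ∈ f w, Group.IsNilpotent P.Carrier ∧
          ∃ φ : G →* P.Carrier, Function.Surjective φ ∧ φ (wordEval s w) ≠ 1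

/-- The lower central series in the numbering `γ₁(G) = G`, `γₙ₊₁(G) = [γₙ(G), G]`
(with `γ₀(G) = G` as well). -/
def lcsTerm (G : Type*) [Group G] (n : ℕ) : Subgroup G :=
  (⊤ : Subgroup G).lowerCentralSeries (n - 1)

/-! The group is built so that how deep certain commutators lie in the lower central series encodes
halting times. For each `n` take a finite 2-group generated by involutions `a`, `b` and a
translation `t`, in which the conjugates of `a` by powers of `t` commute with each other, those of
`b` likewise, and `⁅a, t^k b t^(-k)⁆` is `z^(q k)` with `z` central of order at most two. Here `q`
is the indicator of `Sieve T n`, a periodic set of integers, so it lives on a cyclic group of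
2-power order. The group `DiagLamp` is generated by the diagonal copies of `a`, `b`, `t` in the
product; its coordinates are nilpotent, so it is residually nilpotent.

Write `c k` for the commutator of `a` with `t^k b t^(-k)`. The integer `2^n` lies in the sieve of
index `n`, so `c (2^n) ≠ 1`. If `T n τ` with `n < τ`, then `2^n + 2^τ` lies in no sieve, so `c (2^n
+ 2^τ) = 1`. The conjugates of `b` generate an elementary abelian 2-group, on which commutation with
`t^(2^τ)` is a `2^τ`-fold commutation with `t`. Hence the conjugates of `b` by `t^(2^n)` and `t^(2^n
+ 2^τ)` agree modulo `γ_(2^τ + 1)`, and `c (2^n)` lies in that term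
(`diagCommutator_mem_lowerCentralSeries`).

Let `T` be `HaltsAt`. It is primitive recursive, and a word of length `L` involves only conjugating
exponents bounded in terms of `L`, so a bounded search decides triviality
(`wordEval_diagMarking_eq_one_iff`). An algorithm for the depth of nontrivial words would bound
halting times (`not_exists_depth_diagLamp`). Effective residual nilpotency would supply one: the
class of a finitely presented nilpotent group can be bounded by searching for proofs that all long
enough commutators of generators vanish (`IsEffectivelyResiduallyNilpotent.exists_depth`). -/

open scoped commutatorElement

/-! ### The finite 2-groups with prescribed commutators -/

/-- The class-two group of pairs of `ZMod 2`-valued functions on `A`, with central `ZMod 2` and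
commutators prescribed by `q`, extended by the translations of `A`. An element
`(left, right, centre, shift)` stands for `a^left * b^right * z^centre * t^shift`. -/
@[ext] structure TwistedLamp (A : Type) (q : A → ZMod 2) where
  left : A → ZMod 2
  right : A → ZMod 2
  centre : ZMod 2
  shift : A

namespace TwistedLamp

variable {A : Type} [AddCommGroup A] {q : A → ZMod 2}

/-- Translation of a function. -/
def shiftFun (m : A) (f : A → ZMod 2) : A → ZMod 2 := fun x => f (x - m)

theorem shiftFun_add (m : A) (f g : A → ZMod 2) :
    shiftFun m (f + g) = shiftFun m f + shiftFun m g := rfl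

theorem shiftFun_zero_right (m : A) : shiftFun m (0 : A → ZMod 2) = 0 := rfl

theorem shiftFun_zero (f : A → ZMod 2) : shiftFun 0 f = f := by
  funext x; simp [shiftFun]

theorem shiftFun_shiftFun (m n : A) (f : A → ZMod 2) :
    shiftFun m (shiftFun n f) = shiftFun (m + n) f := by
  funext x; simp [shiftFun, sub_sub]

instance : One (TwistedLamp A q) := ⟨⟨0, 0, 0, 0⟩⟩

@[simp] theorem one_left : (1 : TwistedLamp A q).left = 0 := rfl
@[simp] theorem one_right : (1 : TwistedLamp A q).right = 0 := rfl
@[simp] theorem one_centre : (1 : TwistedLamp A q).centre = 0 := rfl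
@[simp] theorem one_shift : (1 : TwistedLamp A q).shift = 0 := rfl

theorem shiftFun_single [DecidableEq A] (m : A) :
    shiftFun m (Pi.single (0 : A) (1 : ZMod 2)) = Pi.single m 1 := by
  funext x
  simp [shiftFun, Pi.single_apply, sub_eq_zero]

variable [Fintype A]

/-- The bilinear pairing of two functions given by the kernel `q (x - y)`. -/
def pairing (q : A → ZMod 2) (g f : A → ZMod 2) : ZMod 2 :=
  ∑ x, ∑ y, g x * f y * q (x - y)

theorem pairing_add_left (g g' f : A → ZMod 2) :
    pairing q (g + g') f = pairing q g f + pairing q g' f := by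
  simp [pairing, add_mul, Finset.sum_add_distrib]

theorem pairing_add_right (g f f' : A → ZMod 2) :
    pairing q g (f + f') = pairing q g f + pairing q g f' := by
  simp [pairing, mul_add, add_mul, Finset.sum_add_distrib]

theorem pairing_neg_left (g f : A → ZMod 2) : pairing q (-g) f = -pairing q g f := by
  simp [pairing]

theorem pairing_zero_left (f : A → ZMod 2) : pairing q 0 f = 0 := by simp [pairing]

theorem pairing_zero_right (g : A → ZMod 2) : pairing q g 0 = 0 := by simp [pairing]

/-- The kernel depends only on the difference of its arguments. This invariance lets translations
act by automorphisms, and associativity rests on it. -/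
theorem pairing_shiftFun (m : A) (g f : A → ZMod 2) :
    pairing q (shiftFun m g) (shiftFun m f) = pairing q g f := by
  unfold pairing shiftFun
  rw [← Equiv.sum_comp (Equiv.addRight m)]
  refine Finset.sum_congr rfl fun x _ => ?_
  rw [← Equiv.sum_comp (Equiv.addRight m)]
  simp

instance : Mul (TwistedLamp A q) :=
  ⟨fun u v => ⟨u.left + shiftFun u.shift v.left, u.right + shiftFun u.shift v.right,
    u.centre + v.centre + pairing q u.right (shiftFun u.shift v.left), u.shift + v.shift⟩⟩

instance : Inv (TwistedLamp A q) :=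
  ⟨fun u => ⟨-shiftFun (-u.shift) u.left, -shiftFun (-u.shift) u.right,
    -u.centre + pairing q u.right u.left, -u.shift⟩⟩

@[simp] theorem mul_left (u v : TwistedLamp A q) :
    (u * v).left = u.left + shiftFun u.shift v.left := rfl
@[simp] theorem mul_right (u v : TwistedLamp A q) :
    (u * v).right = u.right + shiftFun u.shift v.right := rfl
@[simp] theorem mul_centre (u v : TwistedLamp A q) :
    (u * v).centre = u.centre + v.centre + pairing q u.right (shiftFun u.shift v.left) := rfl
@[simp] theorem mul_shift (u v : TwistedLamp A q) : (u * v).shift = u.shift + v.shift := rfl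

@[simp] theorem inv_left (u : TwistedLamp A q) :
    (u⁻¹).left = -shiftFun (-u.shift) u.left := rfl
@[simp] theorem inv_right (u : TwistedLamp A q) :
    (u⁻¹).right = -shiftFun (-u.shift) u.right := rfl
@[simp] theorem inv_centre (u : TwistedLamp A q) :
    (u⁻¹).centre = -u.centre + pairing q u.right u.left := rfl
@[simp] theorem inv_shift (u : TwistedLamp A q) : (u⁻¹).shift = -u.shift := rfl

instance : Group (TwistedLamp A q) :=
  Group.ofLeftAxioms
    (fun u v w => by
      ext1
      · simp [shiftFun_add, shiftFun_shiftFun, add_assoc]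
      · simp [shiftFun_add, shiftFun_shiftFun, add_assoc]
      · simp only [mul_centre, mul_right, mul_left, mul_shift, pairing_add_left, shiftFun_add,
          pairing_add_right, ← shiftFun_shiftFun, pairing_shiftFun]
        ring
      · simp [add_assoc])
    (fun u => by ext1 <;> simp [shiftFun_zero, pairing_zero_left])
    (fun u => by
      ext1
      · simp
      · simp
      · simp only [mul_centre, inv_centre, inv_right, inv_shift, pairing_neg_left,
          pairing_shiftFun, one_centre]
        ring
      · simp)

/-- The underlying type as a product. -/
def equivProd : TwistedLamp A q ≃ (A → ZMod 2) × (A → ZMod 2) × ZMod 2 × A where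
  toFun u := (u.left, u.right, u.centre, u.shift)
  invFun u := ⟨u.1, u.2.1, u.2.2.1, u.2.2.2⟩
  left_inv _ := rfl
  right_inv _ := rfl

instance : Finite (TwistedLamp A q) := Finite.of_equiv _ equivProd.symm

theorem isNilpotent_of_card {s : ℕ} (h : Fintype.card A = 2 ^ s) :
    Group.IsNilpotent (TwistedLamp A q) := by
  have : IsPGroup 2 (TwistedLamp A q) := by
    refine IsPGroup.of_card (n := 2 ^ s + (2 ^ s + (1 + s))) ?_
    classical
    rw [Nat.card_congr equivProd, Nat.card_eq_fintype_card]
    simp [h, ZMod.card, pow_add]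
  exact this.isNilpotent

/-- The pure translation by `m`. -/
def mover (m : A) : TwistedLamp A q := ⟨0, 0, 0, m⟩

theorem mul_mover (u : TwistedLamp A q) (m : A) :
    u * mover m = ⟨u.left, u.right, u.centre, u.shift + m⟩ := by
  ext1 <;> simp [mover, shiftFun_zero_right, pairing_zero_right]

theorem mover_inv (m : A) : (mover m : TwistedLamp A q)⁻¹ = mover (-m) := by
  ext1 <;> simp [mover, pairing_zero_right, shiftFun_zero_right]

theorem mover_zpow (m : A) (k : ℤ) : (mover m : TwistedLamp A q) ^ k = mover (k • m) := by
  let φ : Multiplicative A →* TwistedLamp A q :=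
    { toFun := fun x => mover x.toAdd
      map_one' := rfl
      map_mul' := fun x y => by rw [mul_mover]; rfl }
  exact (map_zpow φ (Multiplicative.ofAdd m) k).symm

theorem commute_right (g g' : A → ZMod 2) :
    Commute (⟨0, g, 0, 0⟩ : TwistedLamp A q) ⟨0, g', 0, 0⟩ := by
  ext1 <;> simp [shiftFun_zero, pairing_zero_right, add_comm]

theorem right_mul_self (g : A → ZMod 2) :
    (⟨0, g, 0, 0⟩ : TwistedLamp A q) * ⟨0, g, 0, 0⟩ = 1 := by
  ext1
  · simp [shiftFun_zero]
  · simp only [mul_right, shiftFun_zero, one_right]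
    funext x; exact ZModModule.add_self (g x)
  · simp [shiftFun_zero, pairing_zero_right]
  · simp

section Letters

variable [DecidableEq A]

/-- The indicator function of `0` in the left factor. -/
def lampLeft : TwistedLamp A q := ⟨Pi.single 0 1, 0, 0, 0⟩

/-- The indicator function of `0` in the right factor. -/
def lampRight : TwistedLamp A q := ⟨0, Pi.single 0 1, 0, 0⟩

theorem pairing_single_right (g : A → ZMod 2) (m : A) :
    pairing q g (Pi.single m 1) = ∑ x, g x * q (x - m) := by
  unfold pairing
  refine Finset.sum_congr rfl fun x _ => ?_
  rw [Finset.sum_eq_single m] <;> simp +contextual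

theorem pairing_single_single (k m : A) :
    pairing q (Pi.single k 1) (Pi.single m 1) = q (k - m) := by
  rw [pairing_single_right, Finset.sum_eq_single k] <;> simp +contextual

/-- Moving the new left lamp past the right lamps already present costs one value of `q` for each of
them; the word scan records exactly these pairs. -/
theorem mul_lampLeft (u : TwistedLamp A q) :
    u * lampLeft = ⟨u.left + Pi.single u.shift 1, u.right,
      u.centre + ∑ x, u.right x * q (x - u.shift), u.shift⟩ := by
  ext1 <;> simp [lampLeft, shiftFun_single, shiftFun_zero_right, pairing_single_right]

theorem mul_lampRight (u : TwistedLamp A q) :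
    u * lampRight = ⟨u.left, u.right + Pi.single u.shift 1, u.centre, u.shift⟩ := by
  ext1 <;> simp [lampRight, shiftFun_single, shiftFun_zero_right, pairing_zero_right]

theorem lampLeft_inv : (lampLeft : TwistedLamp A q)⁻¹ = lampLeft := by
  ext1 <;> simp [lampLeft, pairing_zero_left, shiftFun_zero, ZModModule.neg_eq_self]

theorem lampRight_inv : (lampRight : TwistedLamp A q)⁻¹ = lampRight := by
  ext1 <;> simp [lampRight, pairing_zero_right, shiftFun_zero, ZModModule.neg_eq_self]

/-- The conjugate of `lampRight` by the translation by `m`. -/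
theorem mover_mul_lampRight (m : A) :
    (mover m * lampRight * (mover m)⁻¹ : TwistedLamp A q) = ⟨0, Pi.single m 1, 0, 0⟩ := by
  rw [mover_inv, mul_mover, mul_lampRight]
  simp [mover]

/-- Commutators of `lampLeft` with conjugates of `lampRight` are prescribed by `q`. -/
theorem commutator_lampLeft (m : A) :
    ⁅(lampLeft : TwistedLamp A q), (mover m * lampRight * (mover m)⁻¹ : TwistedLamp A q)⁆ = ⟨0, 0, q m, 0⟩ := by
  have h : ((⟨0, Pi.single m 1, 0, 0⟩ : TwistedLamp A q))⁻¹ = ⟨0, Pi.single m 1, 0, 0⟩ :=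
    inv_eq_of_mul_eq_one_left (right_mul_self _)
  rw [mover_mul_lampRight, commutatorElement_def, lampLeft_inv, h]
  ext1
  · funext x
    simp [lampLeft, shiftFun_zero, shiftFun_zero_right, ZModModule.add_self]
  · funext x
    simp [lampLeft, shiftFun_zero, shiftFun_zero_right, ZModModule.add_self]
  · simp [lampLeft, shiftFun_zero, shiftFun_zero_right, pairing_zero_right,
      pairing_single_single]
  · simp [lampLeft]

end Letters

end TwistedLamp

/-! ### Descent in the lower central series -/

namespace Subgroup

variable {G : Type*} [Group G]

/-- In an abelian subgroup of exponent two normalised by `t`, commutation with `t ^ 2 ^ s` descends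
`2 ^ s` steps of the lower central series. -/
theorem commutator_pow_two_pow_mem_lowerCentralSeries {t : G} {E : Subgroup G}
    (hcomm : ∀ x ∈ E, ∀ y ∈ E, x * y = y * x) (hsq : ∀ x ∈ E, x * x = 1)
    (hconj : ∀ x ∈ E, t * x * t⁻¹ ∈ E) (s j : ℕ) {x : G} (hx : x ∈ E)
    (hxj : x ∈ (⊤ : Subgroup G).lowerCentralSeries j) :
    ⁅t ^ 2 ^ s, x⁆ ∈ (⊤ : Subgroup G).lowerCentralSeries (j + 2 ^ s) := by
  have hpow : ∀ n : ℕ, ∀ x ∈ E, t ^ n * x * (t ^ n)⁻¹ ∈ E := by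
    intro n
    induction n with
    | zero => intro x hx; simpa using hx
    | succ n ih =>
      intro x hx
      have := hconj _ (ih x hx)
      rw [pow_succ']
      simpa [mul_assoc] using this
  induction s generalizing j x with
  | zero =>
    rw [pow_zero, pow_one, lowerCentralSeries_succ, commutator_comm]
    exact commutator_mem_commutator (mem_top _) hxj
  | succ s ih =>
    have h1 := ih j hx hxj
    have hy := hpow (2 ^ s) x hx
    have hE : ⁅t ^ 2 ^ s, x⁆ ∈ E := E.mul_mem hy (E.inv_mem hx)
    have h2 := ih _ hE h1
    -- In additive notation on `E` this is `(T - 1)^2 = T^2 - 1` in characteristic two.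
    have key : ⁅t ^ 2 ^ s, ⁅t ^ 2 ^ s, x⁆⁆ = ⁅t ^ 2 ^ (s + 1), x⁆ := by
      have hinv : ∀ z ∈ E, z⁻¹ = z := fun z hz => inv_eq_of_mul_eq_one_left (hsq z hz)
      have e : t ^ 2 ^ (s + 1) = t ^ 2 ^ s * t ^ 2 ^ s := by rw [← pow_add]; congr 1; ring
      rw [e]
      set T := t ^ 2 ^ s
      have hy2 := hsq _ hy
      have hc := hcomm _ hy _ hx
      have hT : ⁅T, x⁆ = T * x * T⁻¹ * x := by rw [commutatorElement_def, hinv x hx]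
      rw [commutatorElement_def T ⁅T, x⁆, hinv _ hE, hT, commutatorElement_def, hinv x hx]
      calc T * (T * x * T⁻¹ * x) * T⁻¹ * (T * x * T⁻¹ * x)
          = T * T * x * (T * T)⁻¹ * ((T * x * T⁻¹) * (T * x * T⁻¹)) * x := by group
        _ = _ := by rw [hy2, mul_one]
    rw [key] at h2
    have e : j + 2 ^ (s + 1) = j + 2 ^ s + 2 ^ s := by ring
    rw [e]
    exact h2

/-- If `a` commutes with a translate of `b` that agrees with `b` modulo a normal subgroup, then the
commutator of `a` and `b` lies in this subgroup. -/
theorem commutator_mem_of_commutator_conj_eq_one {N : Subgroup G} [N.Normal] {a b t : G}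
    (h : ⁅a, t * b * t⁻¹⁆ = 1) (ht : ⁅t, b⁆ ∈ N) : ⁅a, b⁆ ∈ N := by
  rw [← QuotientGroup.eq_one_iff] at ht ⊢
  have h' := congrArg (QuotientGroup.mk' N) h
  have ht' : QuotientGroup.mk' N ⁅t, b⁆ = 1 := ht
  change QuotientGroup.mk' N ⁅a, b⁆ = 1
  rw [map_commutatorElement, commutatorElement_eq_one_iff_mul_comm] at ht'
  rw [map_commutatorElement, map_mul, map_mul, map_inv, ht', mul_inv_cancel_right, map_one] at h'
  rw [map_commutatorElement, h']

end Subgroup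

/-! ### Arithmetic of the sieves -/

/-- The integers `k` with lowest binary digit at `n` whose next digit is not at a place `t` with
`T n t`. -/
def Sieve (T : ℕ → ℕ → Prop) (n : ℕ) (k : ℤ) : Prop :=
  k ≡ 2 ^ n [ZMOD 2 ^ (n + 1)] ∧ ∀ t, T n t → ¬ k ≡ 2 ^ n + 2 ^ t [ZMOD 2 ^ (t + 1)]

/-- The relation `T` is a partial function. -/
def IsFunctionalRel (T : ℕ → ℕ → Prop) : Prop := ∀ n t t', T n t → T n t' → t = t'

namespace Sieve

variable {T : ℕ → ℕ → Prop}

theorem two_pow (n : ℕ) : Sieve T n (2 ^ n) := by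
  refine ⟨Int.ModEq.refl _, fun t _ h => ?_⟩
  have h1 := h.dvd
  rw [add_sub_cancel_left, pow_succ] at h1
  have h2 := Int.le_of_dvd (by positivity) h1
  have : (0 : ℤ) < 2 ^ t := by positivity
  linarith

/-- Functionality leaves at most one excluded residue class, so a single power of two is a period.
The period need not be computable from `n`: it shapes the group but never enters the word problem
algorithm. -/
theorem exists_periodic (hT : IsFunctionalRel T) (n : ℕ) :
    ∃ s, n < s ∧ ∀ k l : ℤ, k ≡ l [ZMOD 2 ^ s] → (Sieve T n k ↔ Sieve T n l) := by
  by_cases h : ∃ t, T n t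
  · obtain ⟨t, ht⟩ := h
    refine ⟨n + t + 1, by omega, ?_⟩
    have main : ∀ k l : ℤ, k ≡ l [ZMOD 2 ^ (n + t + 1)] → Sieve T n k → Sieve T n l := by
      intro k l hkl hk
      refine ⟨(hkl.symm.of_dvd (pow_dvd_pow 2 (by omega))).trans hk.1, fun t' ht' h' => ?_⟩
      obtain rfl := hT n t t' ht ht'
      exact hk.2 t ht' ((hkl.of_dvd (pow_dvd_pow 2 (by omega))).trans h')
    exact fun k l hkl => ⟨main k l hkl, main l k hkl.symm⟩
  · push Not at h
    refine ⟨n + 1, by omega, fun k l hkl => ?_⟩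
    simp only [Sieve, h, false_imp_iff, implies_true, and_true]
    exact ⟨hkl.symm.trans, hkl.trans⟩

/-- An exponent `s` such that `Sieve T n` is periodic modulo `2 ^ s`. -/
noncomputable def exponent (hT : IsFunctionalRel T) (n : ℕ) : ℕ := (exists_periodic hT n).choose

theorem lt_exponent (hT : IsFunctionalRel T) (n : ℕ) : n < exponent hT n :=
  (exists_periodic hT n).choose_spec.1

theorem iff_of_modEq (hT : IsFunctionalRel T) {n : ℕ} {k l : ℤ}
    (h : k ≡ l [ZMOD 2 ^ exponent hT n]) : Sieve T n k ↔ Sieve T n l :=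
  (exists_periodic hT n).choose_spec.2 k l h

/-- The integer `2 ^ n + 2 ^ t` with `T n t` and `n < t` belongs to no sieve. -/
theorem not_two_pow_add_two_pow {n t : ℕ} (hnt : n < t) (ht : T n t) (m : ℕ) :
    ¬ Sieve T m (2 ^ n + 2 ^ t) := by
  rintro ⟨h1, h2⟩
  -- The lowest binary digit of the integer is at `n`, which rules out `m ≠ n`; for `m = n` the
  -- integer is in the excluded class.
  rcases lt_trichotomy m n with h | rfl | h
  · have hd : (2 : ℤ) ^ (m + 1) ∣ 2 ^ n + 2 ^ t :=
      dvd_add (pow_dvd_pow 2 (by omega)) (pow_dvd_pow 2 (by omega))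
    have h3 := (Int.modEq_zero_iff_dvd.2 hd).symm.trans h1
    have h4 := Int.le_of_dvd (by positivity) (Int.modEq_zero_iff_dvd.1 h3.symm)
    rw [pow_succ] at h4
    have : (0 : ℤ) < 2 ^ m := by positivity
    linarith
  · exact h2 t ht (Int.ModEq.refl _)
  · have h3 : (2 : ℤ) ^ (n + 1) ∣ 2 ^ n + 2 ^ t := by
      have h5 : (2 : ℤ) ^ (n + 1) ∣ 2 ^ m := pow_dvd_pow 2 (by omega)
      have h6 := (h1.of_dvd (pow_dvd_pow 2 (show n + 1 ≤ m + 1 by omega))).trans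
        (Int.modEq_zero_iff_dvd.2 h5)
      exact Int.modEq_zero_iff_dvd.1 h6
    have h4 := (Int.dvd_add_left (pow_dvd_pow (2 : ℤ) (show n + 1 ≤ t by omega))).1 h3
    have h7 := Int.le_of_dvd (by positivity) h4
    rw [pow_succ] at h7
    have : (0 : ℤ) < 2 ^ n := by positivity
    linarith

open scoped Classical in
/-- The indicator function of the sieve on residues. -/
noncomputable def kernel (hT : IsFunctionalRel T) (n : ℕ) (x : ZMod (2 ^ exponent hT n)) : ZMod 2 :=
  if Sieve T n x.cast then 1 else 0

open scoped Classical in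
theorem kernel_intCast (hT : IsFunctionalRel T) (n : ℕ) (k : ℤ) :
    kernel hT n k = if Sieve T n k then 1 else 0 := by
  have : Sieve T n ((k : ZMod (2 ^ exponent hT n)).cast) ↔ Sieve T n k := by
    refine iff_of_modEq hT ?_
    rw [ZMod.coe_intCast]
    push_cast
    exact Int.mod_modEq _ _
  simp only [kernel, this]

end Sieve

/-! ### The diagonal group, residual nilpotency and deep commutators -/

section LampProduct

open TwistedLamp Sieve

variable {T : ℕ → ℕ → Prop} (hT : IsFunctionalRel T)

/-- The product of the finite groups attached to the sieves. -/
abbrev LampProduct : Type := ∀ n, TwistedLamp (ZMod (2 ^ exponent hT n)) (kernel hT n)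

/-- The three diagonal generators. -/
noncomputable def diagGen : Fin 3 → LampProduct hT :=
  ![fun _ => lampLeft, fun _ => lampRight, fun _ => mover 1]

/-- The group generated by the three diagonal elements. -/
abbrev DiagLamp : Type := Subgroup.closure (Set.range (diagGen hT))

/-- The canonical marking of `DiagLamp`. -/
noncomputable def diagMarking (i : Fin 3) : DiagLamp hT :=
  ⟨diagGen hT i, Subgroup.subset_closure ⟨i, rfl⟩⟩

theorem isMarking_diagMarking : IsMarking (diagMarking hT) := by
  unfold IsMarking
  have h := Subgroup.closure_closure_coe_preimage (k := Set.range (diagGen hT))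
  rw [← h]
  congr 1
  ext x
  simp only [Set.mem_range, Set.mem_preimage, diagMarking, Subtype.ext_iff]

theorem fg_diagLamp : Group.FG (DiagLamp hT) :=
  Group.fg_iff.2 ⟨_, isMarking_diagMarking hT, Set.finite_range _⟩

/-- A nontrivial element is nontrivial in some coordinate, and each coordinate group is a finite
2-group. -/
theorem isResiduallyNilpotent_diagLamp : IsResiduallyNilpotent (DiagLamp hT) := by
  intro g hg
  obtain ⟨n, hn⟩ : ∃ n, g.1 n ≠ 1 := by
    by_contra! h
    exact hg (Subtype.ext (funext h))
  let π : DiagLamp hT →* TwistedLamp (ZMod (2 ^ exponent hT n)) (kernel hT n) :=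
    (Pi.evalMonoidHom (fun n => TwistedLamp (ZMod (2 ^ exponent hT n)) (kernel hT n)) n).comp
      (Subgroup.subtype _)
  have hnil : Group.IsNilpotent (TwistedLamp (ZMod (2 ^ exponent hT n)) (kernel hT n)) :=
    isNilpotent_of_card (s := exponent hT n) (ZMod.card _)
  refine ⟨π.ker, inferInstance, ?_, hn⟩
  have : Group.IsNilpotent π.range := inferInstance
  exact (Group.isNilpotent_congr (QuotientGroup.quotientKerEquivRange π)).2 this

/-- The commutator of the first generator with the conjugate of the second one by the `k`-th power
of the third one. -/
noncomputable def diagCommutator (k : ℕ) : DiagLamp hT :=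
  ⁅diagMarking hT 0, diagMarking hT 2 ^ k * diagMarking hT 1 * (diagMarking hT 2 ^ k)⁻¹⁆

theorem diagCommutator_apply (k n : ℕ) :
    (diagCommutator hT k).1 n = ⟨0, 0, kernel hT n (k : ℤ), 0⟩ := by
  have h : (diagCommutator hT k).1 n = ⁅(lampLeft : TwistedLamp _ (kernel hT n)),
      (mover 1 ^ k * lampRight * (mover 1 ^ k)⁻¹ : TwistedLamp _ (kernel hT n))⁆ := rfl
  have h' := mover_zpow (q := kernel hT n) 1 (k : ℤ)
  rw [zpow_natCast] at h'
  rw [h, h', commutator_lampLeft]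
  simp

theorem diagCommutator_two_pow_ne_one (n : ℕ) : diagCommutator hT (2 ^ n) ≠ 1 := by
  intro h
  have h1 := congrArg (fun g : DiagLamp hT => (g.1 n).centre) h
  have h2 : Sieve T n ((2 ^ n : ℕ) : ℤ) := by exact_mod_cast two_pow (T := T) n
  simp only [diagCommutator_apply, kernel_intCast, h2, if_true] at h1
  exact one_ne_zero h1

/-- If `T n t` then the commutator at `2 ^ n` lies deep in the lower central series. -/
theorem diagCommutator_mem_lowerCentralSeries {n t : ℕ} (hnt : n < t) (ht : T n t) :
    diagCommutator hT (2 ^ n) ∈ (⊤ : Subgroup (DiagLamp hT)).lowerCentralSeries (2 ^ t) := by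
  -- The exponent belongs to no sieve, so every coordinate vanishes. With `2 ^ t` written first,
  -- `pow_add` makes the power `2 ^ t` the outer conjugator.
  have h1 : diagCommutator hT (2 ^ t + 2 ^ n) = 1 := by
    refine Subtype.ext (funext fun m => ?_)
    rw [diagCommutator_apply, kernel_intCast, if_neg]
    · rfl
    · have := not_two_pow_add_two_pow hnt ht m
      rw [add_comm]
      exact_mod_cast this
  rw [diagCommutator, pow_add] at h1
  refine Subgroup.commutator_mem_of_commutator_conj_eq_one
    (t := diagMarking hT 2 ^ 2 ^ t) (by simpa [mul_assoc] using h1) ?_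
  -- The elements with only a right part in each coordinate: abelian of exponent two, stable under
  -- the translation, and containing all conjugates of the second generator by its powers.
  let E : Subgroup (DiagLamp hT) :=
    { carrier := {x | ∀ m, ∃ g, x.1 m = ⟨0, g, 0, 0⟩}
      one_mem' := fun m => ⟨0, rfl⟩
      mul_mem' := fun {x y} hx hy m => by
        obtain ⟨g, hg⟩ := hx m
        obtain ⟨g', hg'⟩ := hy m
        refine ⟨g + g', ?_⟩
        change x.1 m * y.1 m = _
        rw [hg, hg']
        ext1 <;> simp [shiftFun_zero, pairing_zero_right]
      inv_mem' := fun {x} hx m => by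
        obtain ⟨g, hg⟩ := hx m
        refine ⟨g, ?_⟩
        change (x.1 m)⁻¹ = _
        rw [hg]
        exact inv_eq_of_mul_eq_one_left (right_mul_self g) }
  have hconj : ∀ x ∈ E, diagMarking hT 2 * x * (diagMarking hT 2)⁻¹ ∈ E := by
    intro x hx m
    obtain ⟨g, hg⟩ := hx m
    refine ⟨shiftFun 1 g, ?_⟩
    change mover 1 * x.1 m * (mover 1)⁻¹ = _
    rw [hg, mover_inv, mul_mover]
    ext1 <;> simp [mover, shiftFun_zero_right, pairing_zero_left]
  have hpow : ∀ k : ℕ, diagMarking hT 2 ^ k * diagMarking hT 1 * (diagMarking hT 2 ^ k)⁻¹ ∈ E := by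
    intro k
    induction k with
    | zero =>
      simp only [pow_zero, one_mul, inv_one, mul_one]
      exact fun m => ⟨_, rfl⟩
    | succ k ih =>
      have := hconj _ ih
      rw [pow_succ']
      simpa [mul_assoc] using this
  have := Subgroup.commutator_pow_two_pow_mem_lowerCentralSeries (E := E) (t := diagMarking hT 2)
    (fun x hx y hy => Subtype.ext (funext fun m => by
      obtain ⟨g, hg⟩ := hx m
      obtain ⟨g', hg'⟩ := hy m
      change x.1 m * y.1 m = y.1 m * x.1 m
      rw [hg, hg']
      exact commute_right g g'))
    (fun x hx => Subtype.ext (funext fun m => by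
      obtain ⟨g, hg⟩ := hx m
      change x.1 m * x.1 m = 1
      rw [hg]
      exact right_mul_self g))
    hconj t 0 (hpow (2 ^ n)) (Subgroup.mem_top _)
  rwa [zero_add] at this

end LampProduct

/-! ### Symbolic evaluation of words -/

section Scan

open TwistedLamp

/-- The state of a scan of a word in the three diagonal generators: the current height, the heights
of the letters of the first kind, those of the second kind, and the pairs of heights of a letter of
the second kind and a later letter of the first kind. -/
abbrev ScanState : Type := ℕ × List ℕ × List ℕ × List (ℕ × ℕ)

/-- Reading one letter. -/
def scanStep (σ : ScanState) (x : Fin 3 × Bool) : ScanState :=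
  if x.1 = 0 then (σ.1, σ.1 :: σ.2.1, σ.2.2.1, σ.2.2.1.map (fun j => (j, σ.1)) ++ σ.2.2.2)
  else if x.1 = 1 then (σ.1, σ.2.1, σ.1 :: σ.2.2.1, σ.2.2.2)
  else if x.2 = true then (σ.1 + 1, σ.2)
  else (σ.1 - 1, σ.2)

/-- Reading a word from the height `L`. -/
def scanFrom (L : ℕ) (w : GroupWord 3) : ScanState := w.foldl scanStep (L, [], [], [])

/-- The heights of a state are at most `M`. -/
def ScanState.BoundedBy (M : ℕ) (σ : ScanState) : Prop :=
  σ.1 ≤ M ∧ (∀ y ∈ σ.2.1, y ≤ M) ∧ (∀ y ∈ σ.2.2.1, y ≤ M) ∧ ∀ p ∈ σ.2.2.2, p.1 ≤ M ∧ p.2 ≤ M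

theorem ScanState.BoundedBy.scanStep {M : ℕ} {σ : ScanState} (h : σ.BoundedBy M)
    (x : Fin 3 × Bool) : (scanStep σ x).BoundedBy (M + 1) := by
  obtain ⟨h1, h2, h3, h4⟩ := h
  have h2' : ∀ y ∈ σ.2.1, y ≤ M + 1 := fun y hy => (h2 y hy).trans (Nat.le_succ M)
  have h3' : ∀ y ∈ σ.2.2.1, y ≤ M + 1 := fun y hy => (h3 y hy).trans (Nat.le_succ M)
  have h4' : ∀ p ∈ σ.2.2.2, p.1 ≤ M + 1 ∧ p.2 ≤ M + 1 := fun p hp =>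
    ⟨(h4 p hp).1.trans (Nat.le_succ M), (h4 p hp).2.trans (Nat.le_succ M)⟩
  unfold _root_.scanStep
  split_ifs
  · refine ⟨h1.trans (Nat.le_succ M), ?_, h3', ?_⟩
    · simpa using ⟨h1.trans (Nat.le_succ M), h2'⟩
    · intro p hp
      rcases List.mem_append.1 hp with hp | hp
      · obtain ⟨j, hj, rfl⟩ := List.mem_map.1 hp
        exact ⟨h3' j hj, h1.trans (Nat.le_succ M)⟩
      · exact h4' p hp
  · refine ⟨h1.trans (Nat.le_succ M), h2', ?_, h4'⟩
    simpa using ⟨h1.trans (Nat.le_succ M), h3'⟩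
  · exact ⟨Nat.succ_le_succ h1, h2', h3', h4'⟩
  · exact ⟨(Nat.sub_le _ _).trans (h1.trans (Nat.le_succ M)), h2', h3', h4'⟩

theorem scanFrom_concat (L : ℕ) (w : GroupWord 3) (x : Fin 3 × Bool) :
    scanFrom L (w ++ [x]) = scanStep (scanFrom L w) x := by
  simp [scanFrom]

theorem scanFrom_boundedBy (L : ℕ) (w : GroupWord 3) :
    (scanFrom L w).BoundedBy (L + w.length) := by
  induction w using List.reverseRecOn with
  | nil => simp [scanFrom, ScanState.BoundedBy]
  | append_singleton w x ih =>
    rw [scanFrom_concat]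
    simpa [add_assoc] using ih.scanStep x

/-- The height drops by at most one per letter, so a start at least as high as the word is long
keeps the truncated subtraction in `scanStep` exact. -/
theorem le_scanFrom (L : ℕ) (w : GroupWord 3) : L ≤ (scanFrom L w).1 + w.length := by
  induction w using List.reverseRecOn with
  | nil => simp [scanFrom]
  | append_singleton w x ih =>
    rw [scanFrom_concat, List.length_append, List.length_singleton]
    unfold scanStep
    split_ifs <;> simp <;> omega

variable {N : ℕ} [NeZero N] {q : ZMod N → ZMod 2}

/-- The element of a finite group that a state describes. -/
def scanElem (q : ZMod N → ZMod 2) (L : ℕ) (σ : ScanState) : TwistedLamp (ZMod N) q :=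
  ⟨(σ.2.1.map fun y : ℕ => Pi.single ((y : ZMod N) - L) 1).sum,
    (σ.2.2.1.map fun y : ℕ => Pi.single ((y : ZMod N) - L) 1).sum,
    (σ.2.2.2.map fun p => q ((p.1 : ZMod N) - p.2)).sum, (σ.1 : ZMod N) - L⟩

/-- The three generators of a finite group. -/
def lampGen (q : ZMod N → ZMod 2) : Fin 3 → TwistedLamp (ZMod N) q :=
  ![lampLeft, lampRight, mover 1]

theorem sum_list_single_mul (l : List ℕ) (L m : ZMod N) :
    ∑ x, (l.map fun y : ℕ => (Pi.single ((y : ZMod N) - L) 1 : ZMod N → ZMod 2)).sum x * q (x - m)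
      = (l.map fun y : ℕ => q ((y : ZMod N) - L - m)).sum := by
  induction l with
  | nil => simp
  | cons y l ih =>
    simp only [List.map_cons, List.sum_cons, Pi.add_apply, add_mul, Finset.sum_add_distrib, ih]
    congr 1
    rw [Finset.sum_eq_single ((y : ZMod N) - L)] <;> simp +contextual

/-- The scan ignores the signs of the two lamp letters because they are involutions. Positivity of
the height is needed only for the downward move. -/
theorem scanElem_scanStep (L : ℕ) (σ : ScanState) (hσ : 0 < σ.1) (x : Fin 3 × Bool) :
    scanElem q L (scanStep σ x) =
      scanElem q L σ * cond x.2 (lampGen q x.1) (lampGen q x.1)⁻¹ := by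
  obtain ⟨h, la, lb, lp⟩ := σ
  obtain ⟨i, b⟩ := x
  have h0 : (cond b (lampLeft : TwistedLamp (ZMod N) q) lampLeft⁻¹) = lampLeft := by
    cases b <;> simp [lampLeft_inv]
  have h1 : (cond b (lampRight : TwistedLamp (ZMod N) q) lampRight⁻¹) = lampRight := by
    cases b <;> simp [lampRight_inv]
  fin_cases i
  · simp only [lampGen, scanStep]
    simp only [Fin.zero_eta, Matrix.cons_val_zero, if_true, h0, mul_lampLeft, scanElem,
      sum_list_single_mul]
    ext1
    · simp [add_comm]
    · rfl
    · simp [Function.comp_def, add_comm]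
    · rfl
  · simp only [lampGen, scanStep]
    simp [h1, mul_lampRight, scanElem, add_comm]
  · cases b
    · have hh : ((h - 1 : ℕ) : ZMod N) = h - 1 := by
        rw [Nat.cast_sub hσ]; simp
      simp [lampGen, scanStep, mover_inv, mul_mover, scanElem, hh]
      ring
    · simp [lampGen, scanStep, mul_mover, scanElem]
      ring

theorem scanElem_scanFrom (L : ℕ) (w : GroupWord 3) (hw : w.length ≤ L) :
    scanElem q L (scanFrom L w) = wordEval (lampGen q) w := by
  unfold wordEval
  rw [FreeGroup.lift_mk]
  induction w using List.reverseRecOn with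
  | nil =>
    ext1 <;> simp [scanElem, scanFrom]
  | append_singleton w x ih =>
    rw [List.length_append, List.length_singleton] at hw
    have := le_scanFrom L w
    rw [scanFrom_concat, scanElem_scanStep _ _ (by omega), ih (by omega)]
    simp

end Scan

/-! ### Vanishing of sums modulo two -/

section Parity

theorem even_smul_eq_zero {V : Type*} [AddCommGroup V] [Module (ZMod 2) V] {n : ℕ} (h : Even n)
    (v : V) : n • v = 0 := by
  obtain ⟨m, rfl⟩ := h
  rw [add_smul]
  exact ZModModule.add_self _

theorem list_sum_map_eq_zero_of_even_count {ι V : Type*} [DecidableEq ι] [AddCommGroup V]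
    [Module (ZMod 2) V] {l : List ι} (h : ∀ x ∈ l, Even (l.count x)) (f : ι → V) :
    (l.map f).sum = 0 := by
  rw [Finset.sum_list_map_count]
  exact Finset.sum_eq_zero fun x hx => even_smul_eq_zero (h x (List.mem_toFinset.1 hx)) _

theorem list_sum_map_ite {ι : Type*} (p : ι → Prop) [DecidablePred p] (l : List ι) :
    (l.map fun x => if p x then (1 : ZMod 2) else 0).sum = ((l.filter (p ·)).length : ZMod 2) := by
  induction l with
  | nil => simp
  | cons x l ih => by_cases hx : p x <;> simp [hx, ih, add_comm]

/-- Heights below the modulus stay distinct as residues, so the value of the sum at a listed height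
is the parity of its multiplicity. -/
theorem list_sum_single_eq_zero_iff {N M : ℕ} (hN : M < N) {l : List ℕ} (hl : ∀ y ∈ l, y ≤ M)
    (L : ZMod N) :
    (l.map fun y : ℕ => (Pi.single ((y : ZMod N) - L) 1 : ZMod N → ZMod 2)).sum = 0 ↔
      ∀ x ∈ l, Even (l.filter (· = x)).length := by
  constructor
  · intro h x hx
    have h1 : Pi.evalAddMonoidHom (fun _ : ZMod N => ZMod 2) ((x : ZMod N) - L)
        (l.map fun y : ℕ => (Pi.single ((y : ZMod N) - L) 1 : ZMod N → ZMod 2)).sum = 0 :=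
      congrFun h _
    rw [← ZMod.natCast_eq_zero_iff_even, ← list_sum_map_ite]
    rw [map_list_sum, List.map_map] at h1
    refine Eq.trans ?_ h1
    refine congrArg List.sum (List.map_congr_left fun y hy => ?_)
    have : y = x ↔ (x : ZMod N) - L = y - L := by
      rw [sub_left_inj, ZMod.natCast_eq_natCast_iff', Nat.mod_eq_of_lt ((hl y hy).trans_lt hN),
        Nat.mod_eq_of_lt ((hl x hx).trans_lt hN), eq_comm]
    simp [Pi.single_apply, this]
  · intro h
    refine list_sum_map_eq_zero_of_even_count (fun x hx => ?_) _
    have := h x hx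
    rwa [← List.countP_eq_length_filter] at this

end Parity

/-! ### Bounded tests for sieve membership -/

section SieveNat

variable {T : ℕ → ℕ → Prop}

/-- The sieve on differences of natural numbers with search bounded by `B`. -/
def SieveNat (T : ℕ → ℕ → Prop) (B n : ℕ) (p : ℕ × ℕ) : Prop :=
  p.1 % 2 ^ (n + 1) = (p.2 + 2 ^ n) % 2 ^ (n + 1) ∧
    ∀ t < B, ¬ (T n t ∧ p.1 % 2 ^ (t + 1) = (p.2 + 2 ^ n + 2 ^ t) % 2 ^ (t + 1))

theorem natCast_sub_modEq_iff (j i c m : ℕ) :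
    (j : ℤ) - i ≡ c [ZMOD m] ↔ j % m = (i + c) % m := by
  change _ ↔ j ≡ i + c [MOD m]
  rw [← Int.natCast_modEq_iff, Int.modEq_iff_dvd, Int.modEq_iff_dvd]
  push_cast
  rw [show (c : ℤ) - (j - i) = i + c - j by ring]

theorem Sieve.two_pow_le {n : ℕ} {k : ℤ} (h : k ≡ 2 ^ n [ZMOD 2 ^ (n + 1)]) : 2 ^ n ≤ |k| := by
  have h1 : (2 : ℤ) ^ n ∣ k := by
    have := (h.of_dvd (pow_dvd_pow 2 (Nat.le_succ n))).trans (Int.modEq_zero_iff_dvd.2 dvd_rfl)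
    exact Int.modEq_zero_iff_dvd.1 this
  have h2 : k ≠ 0 := by
    rintro rfl
    have h3 := Int.le_of_dvd (by positivity) (Int.modEq_zero_iff_dvd.1 h.symm)
    rw [pow_succ] at h3
    have : (0 : ℤ) < 2 ^ n := by positivity
    linarith
  exact Int.le_of_dvd (abs_pos.2 h2) ((dvd_abs _ _).2 h1)

/-- Let `k` be the difference. Membership in the class of `2 ^ n` forces `2 ^ n ≤ |k|`, and an
exclusion at `t` forces `2 ^ t ≤ |k - 2 ^ n| ≤ 2 * |k| ≤ 2 * M`, so only `t < 2 * M` matter. -/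
theorem sieveNat_iff {n M : ℕ} {p : ℕ × ℕ} (h1 : p.1 ≤ M) (h2 : p.2 ≤ M) :
    SieveNat T (2 * M) n p ↔ Sieve T n ((p.1 : ℤ) - p.2) := by
  have e1 := natCast_sub_modEq_iff p.1 p.2 (2 ^ n) (2 ^ (n + 1))
  have e2 : ∀ t, _ := fun t => natCast_sub_modEq_iff p.1 p.2 (2 ^ n + 2 ^ t) (2 ^ (t + 1))
  push_cast at e1 e2
  unfold SieveNat Sieve
  rw [← e1]
  refine and_congr_right fun h => ⟨fun hh t ht hc => ?_, fun hh t _ ht => hh t ht.1 ?_⟩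
  · refine hh t ?_ ⟨ht, by simpa only [add_assoc] using (e2 t).1 hc⟩
    by_contra htM
    have hk : (p.1 : ℤ) - p.2 - 2 ^ n ≡ 2 ^ t [ZMOD 2 ^ (t + 1)] := by
      simpa using Int.ModEq.sub_right (2 ^ n) hc
    have h3 := Sieve.two_pow_le h
    have h4 := Sieve.two_pow_le hk
    have h5 : (t : ℤ) < 2 ^ t := by exact_mod_cast Nat.lt_two_pow_self
    have h6 : (0 : ℤ) < 2 ^ n := by positivity
    have h7 : |(p.1 : ℤ) - p.2| ≤ M := abs_le.2 ⟨by omega, by omega⟩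
    have h8 := abs_sub ((p.1 : ℤ) - p.2) (2 ^ n)
    rw [abs_of_pos h6] at h8
    push Not at htM
    zify at htM
    linarith
  · rw [e2, ← add_assoc]
    exact ht.2

end SieveNat

/-! ### Solvability of the word problem -/

section WordProblem

open TwistedLamp Sieve

variable {T : ℕ → ℕ → Prop}

open scoped Classical in
/-- The state at the end of the scan of a trivial word that starts at the height `L`. -/
def ScanState.IsTrivial (T : ℕ → ℕ → Prop) (L : ℕ) (σ : ScanState) : Prop :=
  σ.1 = L ∧ (∀ x ∈ σ.2.1, Even (σ.2.1.filter (· = x)).length) ∧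
    (∀ x ∈ σ.2.2.1, Even (σ.2.2.1.filter (· = x)).length) ∧
    ∀ n < 2 * L, Even (σ.2.2.2.filter (SieveNat T (2 * (2 * L)) n ·)).length

theorem diagMarking_wordEval_apply (hT : IsFunctionalRel T) (w : GroupWord 3) (n : ℕ) :
    (wordEval (diagMarking hT) w).1 n = wordEval (lampGen (kernel hT n)) w := by
  let π : DiagLamp hT →* TwistedLamp (ZMod (2 ^ exponent hT n)) (kernel hT n) :=
    (Pi.evalMonoidHom (fun n => TwistedLamp (ZMod (2 ^ exponent hT n)) (kernel hT n)) n).comp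
      (Subgroup.subtype _)
  have : π.comp (FreeGroup.lift (diagMarking hT)) = FreeGroup.lift (lampGen (kernel hT n)) := by
    refine FreeGroup.ext_hom _ _ fun i => ?_
    rw [MonoidHom.comp_apply, FreeGroup.lift_apply_of, FreeGroup.lift_apply_of]
    fin_cases i <;> rfl
  exact DFunLike.congr_fun this (FreeGroup.mk w)

/-- One coordinate with a large modulus reads off the height and the lamp parities exactly. The
centres must be checked separately, but only for `n < 2 * L`, since the later sieves contain no
difference of heights that occurs. -/
theorem wordEval_diagMarking_eq_one_iff (hT : IsFunctionalRel T) (w : GroupWord 3) :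
    wordEval (diagMarking hT) w = 1 ↔
      (scanFrom w.length w).IsTrivial T w.length := by
  classical
  have h0 : wordEval (diagMarking hT) w = 1 ↔
      ∀ n, scanElem (kernel hT n) w.length (scanFrom w.length w) = 1 := by
    simp only [scanElem_scanFrom _ _ le_rfl, ← diagMarking_wordEval_apply]
    rw [Subtype.ext_iff, funext_iff]
    rfl
  rw [h0]
  obtain ⟨b1, b2, b3, b4⟩ := scanFrom_boundedBy w.length w
  rw [← two_mul] at b1 b2 b3 b4
  generalize w.length = L at *
  generalize scanFrom L w = σ at *
  have hcent : ∀ n, (σ.2.2.2.map fun p => kernel hT n ((p.1 : ZMod (2 ^ exponent hT n)) - p.2)).sum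
      = ((σ.2.2.2.filter (SieveNat T (2 * (2 * L)) n ·)).length : ZMod 2) := by
    intro n
    rw [← list_sum_map_ite]
    refine congrArg List.sum (List.map_congr_left fun p hp => ?_)
    have := kernel_intCast hT n ((p.1 : ℤ) - p.2)
    push_cast at this
    rw [this]
    simp only [sieveNat_iff (T := T) (b4 p hp).1 (b4 p hp).2]
  -- All heights are at most `2 * L`, so coordinate `2 * L` does not identify any two of them.
  have hbig : 2 * L < 2 ^ exponent hT (2 * L) :=
    (lt_exponent hT _).trans Nat.lt_two_pow_self
  constructor
  · intro h
    refine ⟨?_, ?_, ?_, fun n _ => ?_⟩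
    · have h1 : (σ.1 : ZMod (2 ^ exponent hT (2 * L))) - L = 0 :=
        congrArg TwistedLamp.shift (h (2 * L))
      rw [sub_eq_zero, ZMod.natCast_eq_natCast_iff', Nat.mod_eq_of_lt (by omega),
        Nat.mod_eq_of_lt (by omega)] at h1
      exact h1
    · exact (list_sum_single_eq_zero_iff hbig b2 _).1 (congrArg TwistedLamp.left (h (2 * L)))
    · exact (list_sum_single_eq_zero_iff hbig b3 _).1 (congrArg TwistedLamp.right (h (2 * L)))
    · rw [← ZMod.natCast_eq_zero_iff_even, ← hcent]
      exact congrArg TwistedLamp.centre (h n)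
  · rintro ⟨h1, h2, h3, h4⟩ n
    have hz : ∀ l : List ℕ, (∀ x ∈ l, Even (l.filter (· = x)).length) →
        (l.map fun y : ℕ => (Pi.single ((y : ZMod (2 ^ exponent hT n)) - L) 1 :
          ZMod (2 ^ exponent hT n) → ZMod 2)).sum = 0 := by
      intro l hl
      refine list_sum_map_eq_zero_of_even_count (fun x hx => ?_) _
      have := hl x hx
      rwa [← List.countP_eq_length_filter] at this
    ext1
    · exact hz _ h2
    · exact hz _ h3
    · refine (hcent n).trans ?_
      by_cases hn : n < 2 * L
      · exact (ZMod.natCast_eq_zero_iff_even).2 (h4 n hn)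
      · rw [List.filter_eq_nil_iff.2]
        · simp
        · intro p hp hc
          rw [decide_eq_true_iff, sieveNat_iff (b4 p hp).1 (b4 p hp).2] at hc
          have h5 := two_pow_le hc.1
          have h6 : (n : ℤ) < 2 ^ n := by exact_mod_cast Nat.lt_two_pow_self
          have h7 := b4 p hp
          have h8 : |(p.1 : ℤ) - p.2| ≤ 2 * L := abs_le.2 ⟨by omega, by omega⟩
          omega
    · simp [scanElem, h1]

theorem primrec_two_pow : Primrec fun n : ℕ => 2 ^ n :=
  (Primrec₂.unpaired'.1 Nat.Primrec.pow).comp (Primrec.const 2) Primrec.id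

theorem primrec_scanStep : Primrec₂ scanStep := by
  have h : Primrec fun p : ScanState × (Fin 3 × Bool) => p.1.1 := Primrec.fst.comp Primrec.fst
  have r : Primrec fun p : ScanState × (Fin 3 × Bool) => p.1.2 := Primrec.snd.comp Primrec.fst
  have la := Primrec.fst.comp r
  have lb := Primrec.fst.comp (Primrec.snd.comp r)
  have lp := Primrec.snd.comp (Primrec.snd.comp r)
  have i : Primrec fun p : ScanState × (Fin 3 × Bool) => p.2.1 := Primrec.fst.comp Primrec.snd
  have b : Primrec fun p : ScanState × (Fin 3 × Bool) => p.2.2 := Primrec.snd.comp Primrec.snd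
  have hm : Primrec fun p : ScanState × (Fin 3 × Bool) =>
      p.1.2.2.1.map (fun j => (j, p.1.1)) :=
    Primrec.list_map lb (Primrec.pair Primrec.snd (h.comp Primrec.fst)).to₂
  refine Primrec.ite (Primrec.eq.comp i (.const 0))
    (h.pair ((Primrec.list_cons.comp h la).pair (lb.pair (Primrec.list_append.comp hm lp)))) ?_
  refine Primrec.ite (Primrec.eq.comp i (.const 1))
    (h.pair (la.pair ((Primrec.list_cons.comp h lb).pair lp))) ?_
  exact Primrec.ite (Primrec.eq.comp b (.const true)) ((Primrec.succ.comp h).pair r)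
    ((Primrec.pred.comp h).pair r)

theorem primrecPred_even : PrimrecPred fun n : ℕ => Even n :=
  (Primrec.eq.comp (Primrec.nat_mod.comp .id (.const 2)) (.const 0)).of_eq fun _ =>
    Nat.even_iff.symm

theorem primrecRel_sieveNat (hT : PrimrecRel T) :
    PrimrecRel fun (p : ℕ × ℕ) (c : ℕ × ℕ) => SieveNat T c.1 c.2 p := by
  have pw : Primrec fun n : ℕ => 2 ^ (n + 1) := primrec_two_pow.comp Primrec.succ
  have j : Primrec fun x : (ℕ × ℕ) × (ℕ × ℕ) => x.1.1 := Primrec.fst.comp Primrec.fst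
  have n : Primrec fun x : (ℕ × ℕ) × (ℕ × ℕ) => x.2.2 := Primrec.snd.comp Primrec.snd
  have c : Primrec fun x : (ℕ × ℕ) × (ℕ × ℕ) => x.1.2 + 2 ^ x.2.2 :=
    Primrec.nat_add.comp (Primrec.snd.comp Primrec.fst) (primrec_two_pow.comp n)
  refine PrimrecPred.and (Primrec.eq.comp (Primrec.nat_mod.comp j (pw.comp n))
    (Primrec.nat_mod.comp c (pw.comp n))) ?_
  have hR : PrimrecRel fun (t : ℕ) (x : (ℕ × ℕ) × (ℕ × ℕ)) => ¬ (T x.2.2 t ∧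
      x.1.1 % 2 ^ (t + 1) = (x.1.2 + 2 ^ x.2.2 + 2 ^ t) % 2 ^ (t + 1)) := by
    have t : Primrec fun y : ℕ × ((ℕ × ℕ) × (ℕ × ℕ)) => y.1 := Primrec.fst
    refine PrimrecPred.not (PrimrecPred.and (hT.comp (n.comp Primrec.snd) t) ?_)
    exact Primrec.eq.comp (Primrec.nat_mod.comp (j.comp Primrec.snd) (pw.comp t))
      (Primrec.nat_mod.comp (Primrec.nat_add.comp (c.comp Primrec.snd) (primrec_two_pow.comp t))
        (pw.comp t))
  refine (hR.forall_mem_list.comp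
    (Primrec.list_range.comp (Primrec.fst.comp Primrec.snd)) Primrec.id).of_eq fun x => ?_
  simp only [List.mem_range, id]

theorem primrecRel_isTrivial (hT : PrimrecRel T) :
    PrimrecRel fun (L : ℕ) (σ : ScanState) => σ.IsTrivial T L := by
  classical
  have r : Primrec fun x : ℕ × ScanState => x.2.2 := Primrec.snd.comp Primrec.snd
  have hcount : PrimrecPred fun l : List ℕ => ∀ x ∈ l, Even (l.filter (· = x)).length := by
    have hR : PrimrecRel fun (x : ℕ) (l : List ℕ) => Even (l.filter (· = x)).length :=
      primrecPred_even.comp (Primrec.list_length.comp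
        ((PrimrecRel.listFilter Primrec.eq).comp Primrec.snd Primrec.fst))
    exact hR.forall_mem_list.comp Primrec.id Primrec.id
  refine PrimrecPred.and (Primrec.eq.comp (Primrec.fst.comp Primrec.snd) Primrec.fst) ?_
  refine PrimrecPred.and (hcount.comp (Primrec.fst.comp r)) ?_
  refine PrimrecPred.and (hcount.comp (Primrec.fst.comp (Primrec.snd.comp r))) ?_
  have hR : PrimrecRel fun (n : ℕ) (x : ℕ × ScanState) =>
      Even (x.2.2.2.2.filter (SieveNat T (2 * (2 * x.1)) n ·)).length := by
    refine primrecPred_even.comp (Primrec.list_length.comp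
      ((PrimrecRel.listFilter (primrecRel_sieveNat hT)).comp
        (g := fun y : ℕ × ℕ × ScanState => y.2.2.2.2.2)
        (h := fun y : ℕ × ℕ × ScanState => (2 * (2 * y.2.1), y.1)) ?_ ?_))
    · exact Primrec.snd.comp (Primrec.snd.comp (r.comp Primrec.snd))
    · exact (Primrec.nat_double.comp (Primrec.nat_double.comp
        (Primrec.fst.comp Primrec.snd))).pair Primrec.fst
  refine (hR.forall_mem_list.comp
    (Primrec.list_range.comp (Primrec.nat_double.comp Primrec.fst)) Primrec.id).of_eq fun x => ?_
  simp only [List.mem_range, id]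

theorem hasSolvableWordProblem_diagLamp (hT : IsFunctionalRel T) (hT' : PrimrecRel T) :
    HasSolvableWordProblem (DiagLamp hT) := by
  refine ⟨3, diagMarking hT, isMarking_diagMarking hT, PrimrecPred.computablePred ?_⟩
  refine PrimrecPred.of_eq ?_ fun w => (wordEval_diagMarking_eq_one_iff hT w).symm
  refine (primrecRel_isTrivial hT').comp Primrec.list_length ?_
  exact Primrec.list_foldl Primrec.id
    (Primrec.pair Primrec.list_length (Primrec.const ([], [], [])))
    (primrec_scanStep.comp (Primrec.fst.comp Primrec.snd) (Primrec.snd.comp Primrec.snd)).to₂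

end WordProblem

/-! ### Commutators of generators and the lower central series -/

section CommutatorWords

/-- The words for the left-normed commutators of weight `n + 1` in the first `m` letters. -/
def commutatorWords (m n : ℕ) : List (List (ℕ × Bool)) :=
  n.rec ((List.range m).map fun i => [(i, true)]) fun _ l =>
    l.flatMap fun u => (List.range m).map fun i =>
      (u ++ [(i, true)]) ++ (FreeGroup.invRev u ++ [(i, false)])

theorem mem_commutatorWords_succ {m n : ℕ} {v : List (ℕ × Bool)} :
    v ∈ commutatorWords m (n + 1) ↔ ∃ u ∈ commutatorWords m n, ∃ i < m,
      (u ++ [(i, true)]) ++ (FreeGroup.invRev u ++ [(i, false)]) = v := by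
  change v ∈ (commutatorWords m n).flatMap _ ↔ _
  simp only [List.mem_flatMap, List.mem_map, List.mem_range]

theorem mk_commutatorWord (u : List (ℕ × Bool)) (i : ℕ) :
    FreeGroup.mk ((u ++ [(i, true)]) ++ (FreeGroup.invRev u ++ [(i, false)])) =
      ⁅FreeGroup.mk u, FreeGroup.of i⁆ := by
  rw [commutatorElement_def, FreeGroup.inv_mk, FreeGroup.of, FreeGroup.inv_mk,
    FreeGroup.mul_mk, FreeGroup.mul_mk, FreeGroup.mul_mk]
  simp [FreeGroup.invRev]

variable {K : Type*} [Group K] {m : ℕ} {ψ : FreeGroup ℕ →* K}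

theorem map_commutatorWords_mem_lowerCentralSeries (ψ : FreeGroup ℕ →* K) (n : ℕ)
    {v : List (ℕ × Bool)} (hv : v ∈ commutatorWords m n) :
    ψ (FreeGroup.mk v) ∈ (⊤ : Subgroup K).lowerCentralSeries n := by
  induction n generalizing v with
  | zero => exact Subgroup.mem_top _
  | succ n ih =>
    obtain ⟨u, hu, i, -, rfl⟩ := mem_commutatorWords_succ.1 hv
    rw [mk_commutatorWord, map_commutatorElement]
    exact Subgroup.commutator_mem_commutator (ih hu) (Subgroup.mem_top _)

/-- Modulo the normal closure of the commutators of the next weight, each commutator of the present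
weight commutes with all generators and so is central. By induction the present term of the series
has central image, so the next term dies. -/
theorem lowerCentralSeries_le_normalClosure_commutatorWords
    (hψ : Subgroup.closure {x | ∃ i < m, ψ (FreeGroup.of i) = x} = ⊤) (n : ℕ) :
    (⊤ : Subgroup K).lowerCentralSeries n ≤
      Subgroup.normalClosure {x | ∃ v ∈ commutatorWords m n, ψ (FreeGroup.mk v) = x} := by
  induction n with
  | zero =>
    rw [Subgroup.lowerCentralSeries_zero, ← hψ, Subgroup.closure_le]
    rintro _ ⟨i, hi, rfl⟩
    exact Subgroup.subset_normalClosure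
      ⟨[(i, true)], List.mem_map.2 ⟨i, List.mem_range.2 hi, rfl⟩, rfl⟩
  | succ n ih =>
    set M := Subgroup.normalClosure
      {x | ∃ v ∈ commutatorWords m (n + 1), ψ (FreeGroup.mk v) = x} with hM
    have hle : Subgroup.normalClosure {x | ∃ v ∈ commutatorWords m n, ψ (FreeGroup.mk v) = x} ≤
        (Subgroup.center (K ⧸ M)).comap (QuotientGroup.mk' M) := by
      refine Subgroup.normalClosure_le_normal ?_
      rintro _ ⟨u, hu, rfl⟩
      have htop : (⊤ : Subgroup K) ≤ (Subgroup.centralizer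
          {QuotientGroup.mk' M (ψ (FreeGroup.mk u))}).comap (QuotientGroup.mk' M) := by
        rw [← hψ, Subgroup.closure_le]
        rintro _ ⟨i, hi, rfl⟩
        rw [SetLike.mem_coe, Subgroup.mem_comap, Subgroup.mem_centralizer_singleton_iff]
        have h1 : ⁅ψ (FreeGroup.mk u), ψ (FreeGroup.of i)⁆ ∈ M := by
          rw [← map_commutatorElement, ← mk_commutatorWord]
          exact Subgroup.subset_normalClosure
            ⟨_, mem_commutatorWords_succ.2 ⟨u, hu, i, hi, rfl⟩, rfl⟩
        rw [← QuotientGroup.eq_one_iff] at h1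
        have h2 : QuotientGroup.mk' M ⁅ψ (FreeGroup.mk u), ψ (FreeGroup.of i)⁆ = 1 := h1
        rw [map_commutatorElement, commutatorElement_eq_one_iff_mul_comm] at h2
        exact h2.symm
      rw [SetLike.mem_coe, Subgroup.mem_comap, Subgroup.mem_center_iff]
      intro g
      obtain ⟨g, rfl⟩ := QuotientGroup.mk'_surjective M g
      have := htop (Subgroup.mem_top g)
      rwa [Subgroup.mem_comap, Subgroup.mem_centralizer_singleton_iff] at this
    rw [Subgroup.lowerCentralSeries_succ, Subgroup.commutator_le]
    intro g hg h _
    have hc := Subgroup.mem_center_iff.1 (Subgroup.mem_comap.1 (hle (ih hg)))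
      (QuotientGroup.mk' M h)
    rw [← QuotientGroup.eq_one_iff]
    change QuotientGroup.mk' M ⁅g, h⁆ = 1
    rw [map_commutatorElement, commutatorElement_eq_one_iff_mul_comm]
    exact hc.symm

end CommutatorWords

/-! ### Certificates for consequences of relators -/

namespace FinPresentation

/-- The homomorphism to the presented group from the free group on all letters. -/
def ofWord (P : FinPresentation) : FreeGroup ℕ →* P.Carrier :=
  (PresentedGroup.mk _).comp
    (FreeGroup.lift fun i : ℕ => if h : i < P.1 then FreeGroup.of (⟨i, h⟩ : Fin P.1) else 1)

/-- A relator, or a word in letters that denote no generator. -/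
def IsRelator (P : FinPresentation) (r : List (ℕ × Bool)) : Prop :=
  r ∈ P.2 ∨ ∀ x ∈ r, P.1 ≤ x.1

theorem ofWord_relator {P : FinPresentation} {r : List (ℕ × Bool)} (hr : P.IsRelator r) :
    P.ofWord (FreeGroup.mk r) = 1 := by
  rcases hr with hr | hr
  · exact PresentedGroup.one_of_mem ⟨r, hr, rfl⟩
  · rw [ofWord, MonoidHom.comp_apply, FreeGroup.lift_mk, List.prod_eq_one, map_one]
    intro y hy
    obtain ⟨x, hx, rfl⟩ := List.mem_map.1 hy
    rw [dif_neg (not_lt.2 (hr x hx))]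
    cases x.2 <;> simp

theorem closure_ofWord (P : FinPresentation) :
    Subgroup.closure {x | ∃ i < P.1, P.ofWord (FreeGroup.of i) = x} = ⊤ := by
  rw [eq_top_iff, ← PresentedGroup.closure_range_of, Subgroup.closure_le]
  rintro _ ⟨i, rfl⟩
  refine Subgroup.subset_closure ⟨i, i.2, ?_⟩
  simp [ofWord, PresentedGroup.of]

/-- Words live in the free group on all of `ℕ`, so letters that denote no generator must be killed
along with the relators. The quotient by both receives a map from the presented group that inverts
`ofWord`. -/
theorem ofWord_eq_one_iff (P : FinPresentation) (x : FreeGroup ℕ) :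
    P.ofWord x = 1 ↔ x ∈ Subgroup.normalClosure (FreeGroup.mk '' {r | P.IsRelator r}) := by
  constructor
  · intro h
    set N := Subgroup.normalClosure (FreeGroup.mk '' {r | P.IsRelator r}) with hN
    have hmem : ∀ r, P.IsRelator r → QuotientGroup.mk' N (FreeGroup.mk r) = 1 := fun r hr =>
      (QuotientGroup.eq_one_iff _).2 (Subgroup.subset_normalClosure ⟨r, hr, rfl⟩)
    let κ : FreeGroup (Fin P.1) →* FreeGroup ℕ ⧸ N :=
      FreeGroup.lift fun i => QuotientGroup.mk' N (FreeGroup.of (i : ℕ))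
    have hκ : κ.comp (FreeGroup.lift fun i : ℕ =>
        if h : i < P.1 then FreeGroup.of (⟨i, h⟩ : Fin P.1) else 1) = QuotientGroup.mk' N := by
      refine FreeGroup.ext_hom _ _ fun i => ?_
      rw [MonoidHom.comp_apply, FreeGroup.lift_apply_of]
      split_ifs with hi
      · simp [κ]
      · rw [map_one]
        refine (hmem [(i, true)] (Or.inr ?_)).symm
        simpa using hi
    have hrel : ∀ r ∈ {x : FreeGroup (Fin P.1) | ∃ r ∈ P.2, relatorElem P.1 r = x}, κ r = 1 := by
      rintro _ ⟨r, hr, rfl⟩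
      exact (DFunLike.congr_fun hκ (FreeGroup.mk r)).trans (hmem r (Or.inl hr))
    let Φ : P.Carrier →* FreeGroup ℕ ⧸ N := PresentedGroup.toGroup hrel
    have hΦ : Φ.comp P.ofWord = QuotientGroup.mk' N := by
      rw [← hκ]
      rfl
    rw [← QuotientGroup.eq_one_iff]
    change QuotientGroup.mk' N x = 1
    rw [← hΦ, MonoidHom.comp_apply, h, map_one]
  · intro h
    rw [← MonoidHom.mem_ker]
    refine Subgroup.normalClosure_le_normal ?_ h
    rintro _ ⟨r, hr, rfl⟩
    exact ofWord_relator hr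

/-- The word of a conjugate of a relator or of its inverse. -/
def conjWord (e : List (ℕ × Bool) × List (ℕ × Bool) × Bool) : List (ℕ × Bool) :=
  (e.1 ++ cond e.2.2 e.2.1 (FreeGroup.invRev e.2.1)) ++ FreeGroup.invRev e.1

theorem mk_conjWord (e : List (ℕ × Bool) × List (ℕ × Bool) × Bool) :
    FreeGroup.mk (conjWord e) = FreeGroup.mk e.1 *
      cond e.2.2 (FreeGroup.mk e.2.1) (FreeGroup.mk e.2.1)⁻¹ * (FreeGroup.mk e.1)⁻¹ := by
  obtain ⟨g, r, b⟩ := e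
  cases b <;> simp [conjWord, FreeGroup.inv_mk, FreeGroup.mul_mk]

/-- The list `l` certifies that the word `v` is freely equal to a product of conjugates of
relators and their inverses. -/
def IsCertificate (P : FinPresentation) (v : List (ℕ × Bool))
    (l : List (List (ℕ × Bool) × List (ℕ × Bool) × Bool)) : Prop :=
  (∀ e ∈ l, P.IsRelator e.2.1) ∧ FreeGroup.reduce (l.flatMap conjWord) = FreeGroup.reduce v

theorem mk_flatMap_conjWord (l : List (List (ℕ × Bool) × List (ℕ × Bool) × Bool)) :
    FreeGroup.mk (l.flatMap conjWord) = (l.map fun e => FreeGroup.mk (conjWord e)).prod := by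
  induction l with
  | nil => rfl
  | cons e l ih => rw [List.flatMap_cons, ← FreeGroup.mul_mk, ih, List.map_cons, List.prod_cons]

/-- A normal closure consists of the products of conjugates of relators and their inverses, and free
equality is equality of reduced words. Triviality thus becomes a search over finite lists with a
primitive recursive check. -/
theorem exists_isCertificate_iff (P : FinPresentation) (v : List (ℕ × Bool)) :
    (∃ l, P.IsCertificate v l) ↔ P.ofWord (FreeGroup.mk v) = 1 := by
  constructor
  · rintro ⟨l, hl, h⟩
    rw [← FreeGroup.reduce.exact h, mk_flatMap_conjWord, map_list_prod, List.prod_eq_one]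
    intro y hy
    simp only [List.map_map, List.mem_map, Function.comp_apply] at hy
    obtain ⟨e, he, rfl⟩ := hy
    have := ofWord_relator (hl e he)
    rw [mk_conjWord, map_mul, map_mul, map_inv]
    cases e.2.2 <;> simp [this, -FreeGroup.inv_mk]
  · intro h
    rw [ofWord_eq_one_iff, Subgroup.normalClosure] at h
    suffices H : ∃ l : List (List (ℕ × Bool) × List (ℕ × Bool) × Bool),
        (∀ e ∈ l, P.IsRelator e.2.1) ∧ FreeGroup.mk (l.flatMap conjWord) = FreeGroup.mk v by
      obtain ⟨l, hl, h⟩ := H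
      exact ⟨l, hl, FreeGroup.reduce.sound h⟩
    generalize FreeGroup.mk v = x at h ⊢
    induction h using Subgroup.closure_induction'' with
    | one => exact ⟨[], by simp, rfl⟩
    | mem x hx =>
      obtain ⟨_, ⟨r, hr, rfl⟩, hx⟩ := Group.mem_conjugatesOfSet_iff.1 hx
      obtain ⟨c, rfl⟩ := isConj_iff.1 hx
      refine ⟨[(c.toWord, r, true)], by simpa using hr, ?_⟩
      simp [mk_conjWord, FreeGroup.mk_toWord]
    | inv_mem x hx =>
      obtain ⟨_, ⟨r, hr, rfl⟩, hx⟩ := Group.mem_conjugatesOfSet_iff.1 hx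
      obtain ⟨c, rfl⟩ := isConj_iff.1 hx
      refine ⟨[(c.toWord, r, false)], by simpa using hr, ?_⟩
      simp [mk_conjWord, FreeGroup.mk_toWord, mul_assoc]
    | mul x y _ _ hx hy =>
      obtain ⟨l, hl, rfl⟩ := hx
      obtain ⟨l', hl', rfl⟩ := hy
      refine ⟨l ++ l', ?_, ?_⟩
      · intro e he
        rcases List.mem_append.1 he with he | he
        exacts [hl e he, hl' e he]
      · rw [List.flatMap_append, FreeGroup.mul_mk]

end FinPresentation

/-! ### Bounding the class of a nilpotent finite presentation -/

section ClassSearch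

open FinPresentation

theorem primrec_invRev {α : Type*} [Primcodable α] :
    Primrec (FreeGroup.invRev : List (α × Bool) → List (α × Bool)) :=
  Primrec.list_reverse.comp (Primrec.list_map Primrec.id
    ((Primrec.fst.comp Primrec.snd).pair (Primrec.not.comp (Primrec.snd.comp Primrec.snd))).to₂)

theorem primrec_reduce : Primrec (FreeGroup.reduce : List (ℕ × Bool) → List (ℕ × Bool)) := by
  have hstep : Primrec₂ fun (_ : List (ℕ × Bool)) (y : (ℕ × Bool) × List (ℕ × Bool)) =>
      (List.casesOn y.2 [y.1] fun hd tl =>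
        if y.1.1 = hd.1 ∧ y.1.2 = not hd.2 then tl else y.1 :: hd :: tl : List (ℕ × Bool)) := by
    have x : Primrec fun p : List (ℕ × Bool) × ((ℕ × Bool) × List (ℕ × Bool)) => p.2.1 :=
      Primrec.fst.comp Primrec.snd
    refine Primrec.list_casesOn (h := fun p y =>
        if p.2.1.1 = y.1.1 ∧ p.2.1.2 = not y.1.2 then y.2 else p.2.1 :: y.1 :: y.2)
      (Primrec.snd.comp Primrec.snd) (Primrec.list_cons.comp x (.const [])) ?_
    have hd : Primrec fun p : (List (ℕ × Bool) × ((ℕ × Bool) × List (ℕ × Bool))) ×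
        ((ℕ × Bool) × List (ℕ × Bool)) => p.2.1 := Primrec.fst.comp Primrec.snd
    have tl : Primrec fun p : (List (ℕ × Bool) × ((ℕ × Bool) × List (ℕ × Bool))) ×
        ((ℕ × Bool) × List (ℕ × Bool)) => p.2.2 := Primrec.snd.comp Primrec.snd
    have x' := x.comp (Primrec.fst (α := List (ℕ × Bool) × ((ℕ × Bool) × List (ℕ × Bool)))
      (β := (ℕ × Bool) × List (ℕ × Bool)))
    refine Primrec.ite (PrimrecPred.and
      (Primrec.eq.comp (Primrec.fst.comp x') (Primrec.fst.comp hd))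
      (Primrec.eq.comp (Primrec.snd.comp x') (Primrec.not.comp (Primrec.snd.comp hd)))) tl ?_
    exact Primrec.list_cons.comp x' (Primrec.list_cons.comp hd tl)
  refine (Primrec.list_foldr Primrec.id (.const []) hstep).of_eq fun L => ?_
  induction L with
  | nil => rfl
  | cons x L ih => exact congrArg _ ih

theorem primrec_commutatorWords : Primrec₂ commutatorWords := by
  have letter : ∀ b : Bool, Primrec fun i : ℕ => [(i, b)] := fun b =>
    Primrec.list_cons.comp (Primrec.id.pair (.const b)) (.const [])
  refine Primrec.nat_rec (f := fun m : ℕ => (List.range m).map fun i => [(i, true)])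
    (g := fun m p => p.2.flatMap fun u => (List.range m).map fun i =>
      (u ++ [(i, true)]) ++ (FreeGroup.invRev u ++ [(i, false)]))
    (Primrec.list_map Primrec.list_range ((letter true).comp Primrec.snd).to₂) ?_
  refine Primrec.list_flatMap (Primrec.snd.comp Primrec.snd) ?_
  refine Primrec.list_map (Primrec.list_range.comp (Primrec.fst.comp Primrec.fst)) ?_
  exact Primrec.list_append.comp
    (Primrec.list_append.comp (Primrec.snd.comp Primrec.fst) ((letter true).comp Primrec.snd))
    (Primrec.list_append.comp (primrec_invRev.comp (Primrec.snd.comp Primrec.fst))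
      ((letter false).comp Primrec.snd))

theorem primrec_conjWord : Primrec conjWord := by
  have r : Primrec fun e : List (ℕ × Bool) × List (ℕ × Bool) × Bool => e.2.1 :=
    Primrec.fst.comp Primrec.snd
  exact Primrec.list_append.comp (Primrec.list_append.comp Primrec.fst
    (Primrec.cond (Primrec.snd.comp Primrec.snd) r (primrec_invRev.comp r)))
    (primrec_invRev.comp Primrec.fst)

theorem primrecRel_isRelator : PrimrecRel fun (r : List (ℕ × Bool)) (P : FinPresentation) =>
    P.IsRelator r := by
  refine PrimrecPred.or ?_ ?_
  · have : PrimrecRel fun (l : List (List (ℕ × Bool))) r => ∃ a ∈ l, a = r :=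
      PrimrecRel.exists_mem_list Primrec.eq
    exact (this.comp (Primrec.snd.comp Primrec.snd) Primrec.fst).of_eq fun x => by simp
  · have : PrimrecRel fun (x : ℕ × Bool) (P : FinPresentation) => P.1 ≤ x.1 :=
      Primrec.nat_le.comp (Primrec.fst.comp Primrec.snd) (Primrec.fst.comp Primrec.fst)
    exact this.forall_mem_list

theorem primrecRel_isCertificate :
    PrimrecRel fun (l : List (List (ℕ × Bool) × List (ℕ × Bool) × Bool))
      (x : List (ℕ × Bool) × FinPresentation) => x.2.IsCertificate x.1 l := by
  refine PrimrecPred.and ?_ ?_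
  · have : PrimrecRel fun (e : List (ℕ × Bool) × List (ℕ × Bool) × Bool) (P : FinPresentation) =>
        P.IsRelator e.2.1 :=
      primrecRel_isRelator.comp (Primrec.fst.comp (Primrec.snd.comp Primrec.fst)) Primrec.snd
    exact this.forall_mem_list.comp Primrec.fst (Primrec.snd.comp Primrec.snd)
  · exact Primrec.eq.comp (primrec_reduce.comp (Primrec.list_flatMap Primrec.fst
      (primrec_conjWord.comp Primrec.snd).to₂)) (primrec_reduce.comp
        (Primrec.fst.comp Primrec.snd))

/-- Certificates with codes below `B` show that the commutators of weight `n + 1` of the generators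
are trivial. -/
def FinPresentation.ClassWitness (P : FinPresentation) (n B : ℕ) : Prop :=
  ∀ v ∈ commutatorWords P.1 n, ∃ z < B, P.IsCertificate v ((Encodable.decode z).getD [])

/-- One number codes both the candidate class and the bound on certificates, so that a single
unbounded search covers all pairs. -/
theorem primrecRel_classWitness : PrimrecRel fun (P : FinPresentation) (n : ℕ) =>
    P.ClassWitness n.unpair.1 n.unpair.2 := by
  have h1 : PrimrecRel fun (z : ℕ) (x : List (ℕ × Bool) × FinPresentation) =>
      x.2.IsCertificate x.1 ((Encodable.decode z).getD []) :=
    primrecRel_isCertificate.comp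
      (Primrec.option_getD.comp (Primrec.decode.comp Primrec.fst) (.const [])) Primrec.snd
  have h2 : PrimrecRel fun (v : List (ℕ × Bool)) (y : FinPresentation × ℕ) =>
      ∃ z < y.2, y.1.IsCertificate v ((Encodable.decode z).getD []) :=
    (h1.exists_mem_list.comp (Primrec.list_range.comp (Primrec.snd.comp Primrec.snd))
      (Primrec.fst.pair (Primrec.fst.comp Primrec.snd))).of_eq fun x => by simp
  exact h2.forall_mem_list.comp
    (primrec_commutatorWords.comp (Primrec.fst.comp Primrec.fst)
      (Primrec.fst.comp (Primrec.unpair.comp Primrec.snd)))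
    (Primrec.fst.pair (Primrec.snd.comp (Primrec.unpair.comp Primrec.snd)))

theorem FinPresentation.ClassWitness.lowerCentralSeries_eq_bot {P : FinPresentation} {n B : ℕ}
    (h : P.ClassWitness n B) : (⊤ : Subgroup P.Carrier).lowerCentralSeries n = ⊥ := by
  rw [eq_bot_iff]
  refine (lowerCentralSeries_le_normalClosure_commutatorWords P.closure_ofWord n).trans ?_
  refine Subgroup.normalClosure_le_normal ?_
  rintro _ ⟨v, hv, rfl⟩
  obtain ⟨z, -, hz⟩ := h v hv
  exact (P.exists_isCertificate_iff v).1 ⟨_, hz⟩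

theorem FinPresentation.exists_classWitness {P : FinPresentation} (h : Group.IsNilpotent P.Carrier) :
    ∃ n B, P.ClassWitness n B := by
  obtain ⟨n, hn⟩ := Subgroup.nilpotent_iff_lowerCentralSeries.1 h
  refine ⟨n, ?_⟩
  have hv : ∀ v ∈ commutatorWords P.1 n, ∃ l, P.IsCertificate v l := by
    intro v hv
    rw [P.exists_isCertificate_iff, ← Subgroup.mem_bot, ← hn]
    exact map_commutatorWords_mem_lowerCentralSeries _ n hv
  choose! c hc using hv
  -- There are finitely many words; the sum of their certificate codes bounds each code, and adding
  -- one makes the bound strict.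
  refine ⟨((commutatorWords P.1 n).map fun v => Encodable.encode (c v)).sum + 1, fun v hv =>
    ⟨Encodable.encode (c v), Nat.lt_succ_of_le (List.single_le_sum (by simp) _
      (List.mem_map.2 ⟨v, hv, rfl⟩)), ?_⟩⟩
  rw [Encodable.encodek]
  exact hc v hv

open scoped Classical in
/-- The search for a bound on the nilpotency class of a presented group. -/
noncomputable def classSearch (P : FinPresentation) : Part ℕ :=
  (Nat.rfind fun n => Part.some (decide (P.ClassWitness n.unpair.1 n.unpair.2))).map
    fun n => n.unpair.1

theorem partrec_classSearch : Partrec classSearch := by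
  classical
  exact (Partrec.rfind (Primrec₂.to_comp primrecRel_classWitness.decide).partrec₂).map
    (Computable.fst.comp (Computable.unpair.comp Computable.snd)).to₂

theorem exists_mem_classSearch {P : FinPresentation} (h : Group.IsNilpotent P.Carrier) :
    ∃ n ∈ classSearch P, (⊤ : Subgroup P.Carrier).lowerCentralSeries n = ⊥ := by
  classical
  obtain ⟨n, B, hw⟩ := exists_classWitness h
  obtain ⟨k, hk, -⟩ := Nat.rfind_min'
    (p := fun n => decide (P.ClassWitness n.unpair.1 n.unpair.2)) (m := Nat.pair n B) (by simpa)
  refine ⟨k.unpair.1, Part.mem_map _ hk, ?_⟩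
  exact (of_decide_eq_true
    (Part.mem_some_iff.1 (Nat.rfind_spec hk)).symm).lowerCentralSeries_eq_bot

/-- An effectively residually nilpotent group has an algorithm that bounds the depth of nontrivial
elements in the lower central series. -/
theorem IsEffectivelyResiduallyNilpotent.exists_depth {G : Type*} [Group G]
    (h : IsEffectivelyResiduallyNilpotent G) :
    ∃ (k : ℕ) (s : Fin k → G), IsMarking s ∧ ∃ f : GroupWord k →. ℕ, Partrec f ∧
      ∀ w : GroupWord k, wordEval s w ≠ 1 → ∃ n ∈ f w, wordEval s w ∉ lcsTerm G n := by
  obtain ⟨k, s, hs, f, hf, hfs⟩ := h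
  -- The successor accounts for the numbering: `lcsTerm G (n + 1)` is `lowerCentralSeries n`.
  refine ⟨k, s, hs, fun w => ((f w).bind classSearch).map Nat.succ,
    (hf.bind (partrec_classSearch.comp Computable.snd).to₂).map
      (Computable.succ.comp Computable.snd).to₂, fun w hw => ?_⟩
  obtain ⟨P, hP, hnil, φ, -, hφ⟩ := hfs w hw
  obtain ⟨n, hn, hbot⟩ := exists_mem_classSearch hnil
  refine ⟨n + 1, Part.mem_map _ (Part.mem_bind hP hn), fun hmem => hφ ?_⟩
  rw [← Subgroup.mem_bot, ← hbot]
  have := Subgroup.mem_map_of_mem φ hmem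
  unfold lcsTerm at this
  rw [Subgroup.map_lowerCentralSeries] at this
  exact Subgroup.lowerCentralSeries_mono n le_top this

end ClassSearch

/-! ### Halting times -/

section Halting

open Nat.Partrec (Code)

/-- The code numbered `n` halts on the input `0` within the bound `t + 1` of the step-indexed
evaluation, but not within the bound `t`. -/
def HaltsAt (n t : ℕ) : Prop :=
  (Code.evaln (t + 1) (Denumerable.ofNat Code n) 0).isSome ∧
    ¬ (Code.evaln t (Denumerable.ofNat Code n) 0).isSome

theorem isSome_evaln_mono {c : Code} {k l : ℕ} (hkl : k ≤ l) (h : (Code.evaln k c 0).isSome) :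
    (Code.evaln l c 0).isSome := by
  obtain ⟨x, hx⟩ := Option.isSome_iff_exists.1 h
  exact Option.isSome_iff_exists.2 ⟨x, Code.evaln_mono hkl hx⟩

theorem isFunctionalRel_haltsAt : IsFunctionalRel HaltsAt := by
  intro n t t' h h'
  rcases lt_trichotomy t t' with hlt | rfl | hlt
  · exact absurd (isSome_evaln_mono hlt h.1) h'.2
  · rfl
  · exact absurd (isSome_evaln_mono hlt h'.1) h.2

theorem primrec_isSome_evaln :
    Primrec₂ fun n t : ℕ => (Code.evaln t (Denumerable.ofNat Code n) 0).isSome :=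
  Primrec.option_isSome.comp (Code.primrec_evaln.comp
    ((Primrec.snd.pair ((Primrec.ofNat Code).comp Primrec.fst)).pair (.const 0)))

theorem primrecRel_haltsAt : PrimrecRel HaltsAt := by
  refine PrimrecPred.and ?_ (PrimrecPred.not ?_)
  · exact Primrec.eq.comp (primrec_isSome_evaln.comp Primrec.fst
      (Primrec.succ.comp Primrec.snd)) (.const true)
  · exact Primrec.eq.comp primrec_isSome_evaln (.const true)

/-- The least successful bound is positive, since evaluation with bound `0` always fails; its
predecessor is the halting time. -/
theorem exists_haltsAt {n k : ℕ} (h : (Code.evaln k (Denumerable.ofNat Code n) 0).isSome) :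
    ∃ t, HaltsAt n t := by
  have hex : ∃ k, (Code.evaln k (Denumerable.ofNat Code n) 0).isSome := ⟨k, h⟩
  obtain ⟨t, ht⟩ : ∃ t, Nat.find hex = t + 1 := by
    refine Nat.exists_eq_succ_of_ne_zero fun h0 => ?_
    have := Nat.find_spec hex
    rw [h0] at this
    simp [Code.evaln] at this
  refine ⟨t, ?_, Nat.find_min hex (by omega)⟩
  rw [← ht]
  exact Nat.find_spec hex

/-- No computable function bounds the halting times. -/
theorem not_computable_of_haltsAt_le {F : ℕ → ℕ} (hF : ∀ n t, HaltsAt n t → t ≤ F n) :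
    ¬ Computable F := by
  intro hc
  -- Running code `n` with bound `F n + 1` would decide whether it halts on `0`.
  have hp : ComputablePred fun n : ℕ =>
      (Code.evaln (F n + 1) (Denumerable.ofNat Code n) 0).isSome = true :=
    Computable.computablePred ((Primrec₂.to_comp primrec_isSome_evaln).comp Computable.id
      (Computable.succ.comp hc) |>.of_eq fun n => by simp)
  refine ComputablePred.halting_problem 0 ?_
  refine ComputablePred.of_eq (p := fun c : Code =>
    (Code.evaln (F (Encodable.encode c) + 1)
      (Denumerable.ofNat Code (Encodable.encode c)) 0).isSome = true) ?_ fun c => ?_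
  · exact Computable.computablePred ((hp.decide.comp Computable.encode).of_eq fun c => rfl)
  · rw [Denumerable.ofNat_encode]
    constructor
    · intro h
      obtain ⟨x, hx⟩ := Option.isSome_iff_exists.1 h
      exact Part.dom_iff_mem.2 ⟨x, Code.evaln_sound hx⟩
    · intro h
      obtain ⟨x, hx⟩ := Part.dom_iff_mem.1 h
      obtain ⟨k, hk⟩ := Code.evaln_complete.1 hx
      obtain ⟨t, ht⟩ := exists_haltsAt (n := Encodable.encode c) (k := k) (by
        rw [Denumerable.ofNat_encode]
        exact Option.isSome_iff_exists.2 ⟨x, hk⟩)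
      have := isSome_evaln_mono (Nat.succ_le_succ (hF _ _ ht)) ht.1
      rwa [Denumerable.ofNat_encode] at this

end Halting

/-! ### Test words over an arbitrary marking and the conclusion -/

section CommutatorOfWords

variable {k : ℕ}

theorem IsMarking.exists_wordEval {G : Type*} [Group G] {s : Fin k → G} (hs : IsMarking s)
    (g : G) : ∃ w, wordEval s w = g := by
  have h : (FreeGroup.lift s).range = ⊤ := by rw [FreeGroup.range_lift_eq_closure]; exact hs
  obtain ⟨x, hx⟩ := MonoidHom.range_eq_top.1 h g
  exact ⟨x.toWord, by rw [wordEval, FreeGroup.mk_toWord, hx]⟩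

/-- The word for the commutator of `a` with the conjugate of `b` by the `n`-th power of `t`. -/
def conjCommutatorWord (a b t : GroupWord k) (n : ℕ) : GroupWord k :=
  let u := (List.range n).flatMap fun _ => t
  let c := (u ++ b) ++ FreeGroup.invRev u
  ((a ++ c) ++ FreeGroup.invRev a) ++ FreeGroup.invRev c

theorem wordEval_conjCommutatorWord {G : Type*} [Group G] (s : Fin k → G) (a b t : GroupWord k)
    (n : ℕ) : wordEval s (conjCommutatorWord a b t n) =
      ⁅wordEval s a, wordEval s t ^ n * wordEval s b * (wordEval s t ^ n)⁻¹⁆ := by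
  have hu : ∀ n : ℕ, FreeGroup.mk ((List.range n).flatMap fun _ => t) = FreeGroup.mk t ^ n := by
    intro n
    induction n with
    | zero => rfl
    | succ n ih =>
      rw [List.range_succ, List.flatMap_append, ← FreeGroup.mul_mk, ih, pow_succ]
      simp
  simp only [wordEval, conjCommutatorWord, ← FreeGroup.mul_mk, ← FreeGroup.inv_mk, hu, map_mul,
    map_inv, map_pow, commutatorElement_def]

theorem primrec_conjCommutatorWord (a b t : GroupWord k) : Primrec (conjCommutatorWord a b t) := by
  have hu : Primrec fun n : ℕ => (List.range n).flatMap fun _ => t :=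
    Primrec.list_flatMap Primrec.list_range (Primrec.const t).to₂
  have hc := Primrec.list_append.comp (Primrec.list_append.comp hu (.const b)) (primrec_invRev.comp hu)
  exact Primrec.list_append.comp (Primrec.list_append.comp
    (Primrec.list_append.comp (.const a) hc) (.const _)) (primrec_invRev.comp hc)

end CommutatorOfWords

/-- Fixed words for the three diagonal generators exist over any marking, so the test words for the
commutators at `2 ^ n` are computable in `n`. A depth algorithm run on them would bound the halting
times. -/
theorem not_exists_depth_diagLamp (k : ℕ) (s : Fin k → DiagLamp isFunctionalRel_haltsAt)
    (hs : IsMarking s) :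
    ¬ ∃ f : GroupWord k →. ℕ, Partrec f ∧ ∀ w : GroupWord k, wordEval s w ≠ 1 →
      ∃ n ∈ f w, wordEval s w ∉ lcsTerm (DiagLamp isFunctionalRel_haltsAt) n := by
  rintro ⟨f, hf, hfs⟩
  obtain ⟨a, ha⟩ := hs.exists_wordEval (diagMarking isFunctionalRel_haltsAt 0)
  obtain ⟨b, hb⟩ := hs.exists_wordEval (diagMarking isFunctionalRel_haltsAt 1)
  obtain ⟨t, ht⟩ := hs.exists_wordEval (diagMarking isFunctionalRel_haltsAt 2)
  have hw : ∀ n, wordEval s (conjCommutatorWord a b t (2 ^ n)) =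
      diagCommutator isFunctionalRel_haltsAt (2 ^ n) := fun n => by
    rw [wordEval_conjCommutatorWord, ha, hb, ht]
    rfl
  have hd : ∀ n, ∃ N ∈ f (conjCommutatorWord a b t (2 ^ n)),
      diagCommutator isFunctionalRel_haltsAt (2 ^ n) ∉
        lcsTerm (DiagLamp isFunctionalRel_haltsAt) N := fun n => by
    rw [← hw]
    exact hfs _ (by rw [hw]; exact diagCommutator_two_pow_ne_one _ n)
  choose D hD hDs using hd
  have hDc : Computable D :=
    (hf.comp ((primrec_conjCommutatorWord a b t).comp primrec_two_pow).to_comp).of_eq_tot hD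
  -- Adding `n` covers halting times `t ≤ n`, to which the descent does not apply. If `t` exceeded
  -- `n + D n`, then `D n - 1 ≤ 2 ^ t` would put the commutator in the term that it avoids.
  refine not_computable_of_haltsAt_le (F := fun n => n + D n) (fun n t h => ?_)
    (Primrec.nat_add.to_comp.comp Computable.id hDc)
  by_contra! hlt
  refine hDs n (Subgroup.lowerCentralSeries_antitone _ ?_
    (diagCommutator_mem_lowerCentralSeries isFunctionalRel_haltsAt (by omega : n < t) h))
  have := Nat.lt_two_pow_self (n := t)
  omega

theorem mainTheorem8 :
    ∃ (H : Type) (_ : Group H),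
      Group.FG H ∧ IsResiduallyNilpotent H ∧ HasSolvableWordProblem H ∧
      ¬ IsEffectivelyResiduallyNilpotent H ∧
      ∀ (k : ℕ) (s : Fin k → H), IsMarking s →
        ¬ ∃ f : GroupWord k →. ℕ, Partrec f ∧
          ∀ w : GroupWord k, wordEval s w ≠ 1 →
            ∃ n ∈ f w, wordEval s w ∉ lcsTerm H n := by
  refine ⟨DiagLamp isFunctionalRel_haltsAt, inferInstance, fg_diagLamp _,
    isResiduallyNilpotent_diagLamp _, hasSolvableWordProblem_diagLamp _ primrecRel_haltsAt, ?_,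
    not_exists_depth_diagLamp⟩
  intro h
  obtain ⟨k, s, hs, hf⟩ := h.exists_depth
  exact not_exists_depth_diagLamp k s hs hf
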